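/- Let $\Omega\subset\mathbb R^2$ be a bounded open set with $0\in\Omega$. Let $b:\Omega\to\mathbb R^2$ belong to the weak Lebesgue space $L_{2,w}(\Omega)$, that is, $b$ is measurable and $\sup_{\lambda>0}\lambda\,|\{x\in\Omega:|b(x)|>\lambda\}|^{1/2}<\infty$, and assume that $\operatorname{div} b=0$ in $\mathcal D'(\Omega)$. For $\alpha\in\mathbb R$ put $b^{(\alpha)}(x):=b(x)-\alpha\,\frac{x}{|x|^2}$. Then $b^{(\alpha)}$ is locally integrable in $\Omega$ and $$\operatorname{div} b^{(\alpha)}=-2\pi\alpha\,\delta_0\quad\text{in }\mathcal D'(\Omega).$$ Moreover, let $p>2$ and let $v$ belong to $\overset{\circ}{W}{}^1_p(\Omega)$, the closure of $C_0^\infty(\Omega)$ in the norm of $W^1_p(\Omega)$. Then $v$ has a representative that is continuous on $\overline\Omega$ (its value at the origin is denoted by $v(0)$), the function $(b^{(\alpha)}\cdot\nabla v)\,v$ is integrable over $\Omega$, and $$\mathcal B_\alpha[v,v]:=\int_\Omega b^{(\alpha)}\cdot\nabla v\;v\,dx=\pi\alpha\,|v(0)|^2 .$$ -/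

import Mathlib

open MeasureTheory Set
open scoped ENNReal ContDiff

noncomputable section

/-- The Euclidean plane. -/
abbrev Plane : Type := EuclideanSpace ℝ (Fin 2)

/-- `φ ∈ C₀^∞(Ω)`: smooth, with compact support contained in `Ω`. -/
structure IsTestFunction (Ω : Set Plane) (φ : Plane → ℝ) : Prop where
  contDiff : ContDiff ℝ ∞ φ
  hasCompactSupport : HasCompactSupport φ
  tsupport_subset : tsupport φ ⊆ Ω

/-- The weak Lebesgue quasi-norm `sup_{t > 0} t |{x ∈ Ω : |b(x)| > t}|^{1/2}`. -/
def weakL2Norm (Ω : Set Plane) (b : Plane → Plane) : ℝ≥0∞ :=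
  ⨆ (t : ℝ) (_ : 0 < t), ENNReal.ofReal t * volume {x | x ∈ Ω ∧ t < ‖b x‖} ^ (1 / 2 : ℝ)

/-- `b ∈ L_{2,w}(Ω)`. -/
def MemWeakL2 (Ω : Set Plane) (b : Plane → Plane) : Prop :=
  AEStronglyMeasurable b (volume.restrict Ω) ∧ weakL2Norm Ω b < ⊤

/-- `div b = T` in `𝓓'(Ω)`, for a locally integrable field `b` on `Ω`; the distribution `T` is
given by its values on test functions. -/
def HasDistribDivergence (Ω : Set Plane) (b : Plane → Plane) (T : (Plane → ℝ) → ℝ) : Prop :=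
  LocallyIntegrableOn b Ω ∧
    ∀ φ : Plane → ℝ, IsTestFunction Ω φ → -∫ x in Ω, inner ℝ (b x) (gradient φ x) = T φ

/-- The field `G` is the weak gradient of `u` in `Ω`. -/
def HasWeakGradient (Ω : Set Plane) (u : Plane → ℝ) (G : Plane → Plane) : Prop :=
  LocallyIntegrableOn u Ω ∧ LocallyIntegrableOn G Ω ∧
    ∀ φ : Plane → ℝ, IsTestFunction Ω φ → ∀ i : Fin 2,
      ∫ x in Ω, u x * gradient φ x i = -∫ x in Ω, G x i * φ x

/-- `u` belongs to the closure of `C₀^∞(Ω)` in `W^1_p(Ω)`. -/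
def MemW1pZero (Ω : Set Plane) (p : ℝ≥0∞) (u : Plane → ℝ) : Prop :=
  ∃ G : Plane → Plane, HasWeakGradient Ω u G ∧
    MemLp u p (volume.restrict Ω) ∧ MemLp G p (volume.restrict Ω) ∧
    ∀ ε : ℝ≥0∞, 0 < ε → ∃ φ : Plane → ℝ, IsTestFunction Ω φ ∧
      eLpNorm (fun x => u x - φ x) p (volume.restrict Ω) ≤ ε ∧
      eLpNorm (fun x => G x - gradient φ x) p (volume.restrict Ω) ≤ ε

/-- The total drift `b^{(α)}(x) = b(x) - α x / |x|²`. -/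
def totalDrift (b : Plane → Plane) (α : ℝ) (x : Plane) : Plane :=
  b x - (α / ‖x‖ ^ 2) • x

/-- The integrand `(b^{(α)} · ∇u) η`, where `Du` stands for the (weak) gradient of `u`. -/
def driftIntegrand (b : Plane → Plane) (α : ℝ) (Du : Plane → Plane) (η : Plane → ℝ)
    (x : Plane) : ℝ :=
  inner ℝ (totalDrift b α x) (Du x) * η x

/-- The bilinear form `B_α[u, η] = ∫_Ω (b^{(α)} · ∇u) η dx`, with `Du` the gradient of `u`. -/
def driftForm (Ω : Set Plane) (b : Plane → Plane) (α : ℝ) (Du : Plane → Plane)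
    (η : Plane → ℝ) : ℝ :=
  ∫ x in Ω, driftIntegrand b α Du η x

end

open Filter Topology

/-! Polar coordinates and the fundamental theorem of calculus along rays give div (x / |x|²) = 2π
δ₀, so subtracting α x / |x|² from a solenoidal field creates the source -2πα δ₀. For a test
function φ one has φ ∇φ = ∇(φ²) / 2, and φ² is again a test function; hence B_α[φ, φ] is half of 2πα
φ(0)².

The rest is density. Weak L² on a bounded set lies in L^q for q < 2 (`exists_eLpNorm_le_of_weakL2`),
so the drift pairs with ∇v ∈ L^p, p > 2, by Hölder's inequality. The same divergence formula,
translated to a point y, represents φ(y) by ∇φ and gives |φ(y)| ≤ C ‖∇φ‖_p uniformly in y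
(`exists_enorm_le_eLpNorm_gradient`). The approximating test functions, which vanish outside Ω,
therefore converge uniformly on the whole plane. This produces the continuous representative without
any regularity of the boundary, and both sides of the identity pass to the limit. -/

/-- A uniform `L^q` bound, `q < 2`, for functions in the weak space `L^{2,w}` of a finite measure:
the constant depends only on the mass and on the weak norm. -/
theorem exists_eLpNorm_le_of_weakL2 {X E : Type*} [MeasurableSpace X] [NormedAddCommGroup E]
    {M K q : ℝ≥0∞} (hM : M ≠ ⊤) (hK : K ≠ ⊤) (hq1 : 1 ≤ q) (hq2 : q < 2) :
    ∃ C : ℝ≥0∞, C ≠ ⊤ ∧ ∀ (μ : Measure X) (f : X → E), μ univ ≤ M → AEStronglyMeasurable f μ →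
      (∀ t : ℝ, 0 < t → μ {x | t < ‖f x‖} ≤ K * ENNReal.ofReal (t ^ (-2 : ℝ))) →
      eLpNorm f q μ ≤ C := by
  have hqt : q ≠ ⊤ := (hq2.trans_le le_top).ne
  have hq0 : q ≠ 0 := (zero_lt_one.trans_le hq1).ne'
  have hr1 : 1 ≤ q.toReal := by
    simpa using (ENNReal.toReal_le_toReal ENNReal.one_ne_top hqt).2 hq1
  have hr2 : q.toReal < 2 := by
    simpa using (ENNReal.toReal_lt_toReal hqt ENNReal.ofNat_ne_top).2 hq2
  set r := q.toReal with hr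
  -- Majorant of the layer-cake integrand. The mass bound serves for t ≤ 1, where r - 1 > -1; the
  -- weak bound serves for t > 1, where r - 3 < -1 because r < 2.
  let h : ℝ → ℝ≥0∞ := fun t => min M (K * ENNReal.ofReal (t ^ (-2 : ℝ))) * ENNReal.ofReal (t ^ (r - 1))
  have hfin : ∫⁻ t in Ioi (0 : ℝ), h t ≠ ⊤ := by
    rw [← Ioc_union_Ioi_eq_Ioi (zero_le_one (α := ℝ))]
    refine ((lintegral_union_le _ _ _).trans_lt (ENNReal.add_lt_top.2 ⟨?_, ?_⟩)).ne
    · calc ∫⁻ t in Ioc (0 : ℝ) 1, h t ≤ ∫⁻ t in Ioc (0 : ℝ) 1, M * ENNReal.ofReal (t ^ (r - 1)) :=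
            lintegral_mono fun t => by
              dsimp only [h]; gcongr; exact min_le_left _ _
        _ = M * ∫⁻ t in Ioc (0 : ℝ) 1, ENNReal.ofReal (t ^ (r - 1)) :=
            lintegral_const_mul' _ _ hM
        _ < ⊤ := by
            refine ENNReal.mul_lt_top hM.lt_top (Integrable.lintegral_lt_top ?_)
            exact (intervalIntegrable_iff_integrableOn_Ioc_of_le zero_le_one).1
              (intervalIntegral.intervalIntegrable_rpow' (by linarith))
    · calc ∫⁻ t in Ioi (1 : ℝ), h t
          ≤ ∫⁻ t in Ioi (1 : ℝ), K * ENNReal.ofReal (t ^ (r - 3)) := by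
            refine setLIntegral_mono' measurableSet_Ioi fun t ht => ?_
            have ht0 : (0 : ℝ) < t := zero_lt_one.trans ht
            calc h t ≤ (K * ENNReal.ofReal (t ^ (-2 : ℝ))) * ENNReal.ofReal (t ^ (r - 1)) := by
                  dsimp only [h]; gcongr; exact min_le_right _ _
              _ = K * ENNReal.ofReal (t ^ (r - 3)) := by
                  rw [mul_assoc, ← ENNReal.ofReal_mul (by positivity), ← Real.rpow_add ht0]
                  ring_nf
        _ = K * ∫⁻ t in Ioi (1 : ℝ), ENNReal.ofReal (t ^ (r - 3)) :=
            lintegral_const_mul' _ _ hK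
        _ < ⊤ := by
            refine ENNReal.mul_lt_top hK.lt_top (Integrable.lintegral_lt_top ?_)
            exact integrableOn_Ioi_rpow_of_lt (by linarith) zero_lt_one
  refine ⟨(ENNReal.ofReal r * ∫⁻ t in Ioi (0 : ℝ), h t) ^ (1 / r), ?_, fun μ f hμ hf hw => ?_⟩
  · exact ENNReal.rpow_ne_top_of_nonneg (by positivity) (ENNReal.mul_ne_top ENNReal.ofReal_ne_top hfin)
  · rw [eLpNorm_eq_lintegral_rpow_enorm_toReal hq0 hqt]
    refine ENNReal.rpow_le_rpow ?_ (by positivity)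
    calc ∫⁻ x, ‖f x‖ₑ ^ q.toReal ∂μ = ∫⁻ x, ENNReal.ofReal (‖f x‖ ^ r) ∂μ := by
          refine lintegral_congr fun x => ?_
          rw [← ofReal_norm, ENNReal.ofReal_rpow_of_nonneg (norm_nonneg _) (by positivity)]
      _ = ENNReal.ofReal r * ∫⁻ t in Ioi 0, μ {x | t < ‖f x‖} * ENNReal.ofReal (t ^ (r - 1)) :=
          lintegral_rpow_eq_lintegral_meas_lt_mul μ
            (Filter.Eventually.of_forall fun x => norm_nonneg (f x))
            hf.norm.aemeasurable (by linarith)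
      _ ≤ _ := by
          refine mul_le_mul' le_rfl (setLIntegral_mono' measurableSet_Ioi fun t ht => ?_)
          dsimp only [h]
          gcongr
          exact le_min ((measure_mono (subset_univ _)).trans hμ) (hw t ht)

/-- The exponent conjugate to `p > 2` lies in `[1, 2)`. -/
theorem exists_holderConjugate_lt_two {p : ℝ≥0∞} (hp : 2 < p) :
    ∃ q : ℝ≥0∞, 1 ≤ q ∧ q < 2 ∧ ENNReal.HolderTriple q p 1 := by
  have hp1 : 1 ≤ p := le_trans (by norm_num) hp.le
  have hc : ENNReal.HolderConjugate p (ENNReal.conjExponent p) :=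
    ENNReal.HolderConjugate.conjExponent hp1
  have hs := ENNReal.HolderConjugate.inv_add_inv_eq_one p (ENNReal.conjExponent p)
  refine ⟨ENNReal.conjExponent p, hc.symm.one_le, ?_, hc.symm⟩
  -- With q ≥ 2 and p > 2 the reciprocals would sum to less than 1.
  by_contra! h2
  have h3 : (ENNReal.conjExponent p)⁻¹ ≤ 2⁻¹ := ENNReal.inv_le_inv.2 h2
  have h4 : p⁻¹ < 2⁻¹ := ENNReal.inv_lt_inv.2 hp
  have := ENNReal.add_lt_add_of_lt_of_le (h3.trans_lt (by simp)).ne h4 h3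
  rw [hs, ENNReal.inv_two_add_inv_two] at this
  exact lt_irrefl _ this

theorem measure_lt_norm_le_weakL2Norm {Ω : Set Plane} {b : Plane → Plane}
    (hΩ : MeasurableSet Ω) {t : ℝ} (ht : 0 < t) :
    volume.restrict Ω {x | t < ‖b x‖} ≤ weakL2Norm Ω b ^ 2 * ENNReal.ofReal (t ^ (-2 : ℝ)) := by
  have h1 : ENNReal.ofReal t * volume {x | x ∈ Ω ∧ t < ‖b x‖} ^ (1 / 2 : ℝ) ≤ weakL2Norm Ω b :=
    le_iSup₂_of_le t ht le_rfl
  have h2 : volume.restrict Ω {x | t < ‖b x‖} = volume {x | x ∈ Ω ∧ t < ‖b x‖} := by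
    rw [Measure.restrict_apply' hΩ, inter_comm]; rfl
  rw [h2]
  set V := volume {x | x ∈ Ω ∧ t < ‖b x‖}
  have h3 : V = (V ^ (1 / 2 : ℝ)) ^ 2 := by
    rw [← ENNReal.rpow_natCast, ← ENNReal.rpow_mul]; norm_num
  have h4 : ENNReal.ofReal (t ^ (-2 : ℝ)) = ((ENNReal.ofReal t) ^ 2)⁻¹ := by
    rw [← ENNReal.ofReal_pow ht.le, ← ENNReal.ofReal_inv_of_pos (by positivity),
      Real.rpow_neg ht.le, ← Real.rpow_natCast]
    norm_num
  rw [h4, ← div_eq_mul_inv, ENNReal.le_div_iff_mul_le (by simp [ht]) (by simp), h3, ← mul_pow,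
    mul_comm]
  gcongr

theorem MemWeakL2.memLp {Ω : Set Plane} (hΩ : IsOpen Ω) (hΩb : Bornology.IsBounded Ω)
    {b : Plane → Plane} (hb : MemWeakL2 Ω b) {q : ℝ≥0∞} (hq1 : 1 ≤ q) (hq2 : q < 2) :
    MemLp b q (volume.restrict Ω) := by
  obtain ⟨C, hC, h⟩ := exists_eLpNorm_le_of_weakL2 (X := Plane) (E := Plane)
    (hΩb.measure_lt_top (μ := volume)).ne
    (ENNReal.pow_ne_top (n := 2) hb.2.ne) hq1 hq2
  refine ⟨hb.1, (h _ b (by simp) hb.1 fun t ht => ?_).trans_lt hC.lt_top⟩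
  exact measure_lt_norm_le_weakL2Norm hΩ.measurableSet ht

/-! ### The field x / |x|² and its divergence -/

/-- The field `x / |x|²`. -/
noncomputable def radialField (x : Plane) : Plane := (1 / ‖x‖ ^ 2) • x

theorem norm_radialField (x : Plane) : ‖radialField x‖ = ‖x‖⁻¹ := by
  rw [radialField, norm_smul]
  -- At the origin both sides are 0, by the convention for division by zero.
  rcases eq_or_ne ‖x‖ 0 with h | h
  · simp [h]
  · simp; field_simp

theorem measurable_radialField : Measurable radialField := by
  unfold radialField; fun_prop

/-- The superlevel set lies in the ball of radius 1/t about y, of area π t⁻². The bound does not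
depend on y, which makes the later Sobolev constant uniform. -/
theorem volume_lt_norm_radialField_le (y : Plane) {t : ℝ} (ht : 0 < t) :
    volume {x | t < ‖radialField (x - y)‖} ≤
      ENNReal.ofReal Real.pi * ENNReal.ofReal (t ^ (-2 : ℝ)) := by
  have hs : {x | t < ‖radialField (x - y)‖} ⊆ Metric.ball y t⁻¹ := by
    intro x hx
    have hx : t < ‖x - y‖⁻¹ := by simpa only [mem_ofPred_eq, norm_radialField] using hx
    rw [mem_ball_iff_norm]
    exact (lt_inv_comm₀ ht (inv_pos.1 (ht.trans hx))).1 hx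
  refine (measure_mono hs).trans_eq ?_
  rw [EuclideanSpace.volume_ball_fin_two, mul_comm, ← ENNReal.ofReal_pow (by positivity)]
  congr 2
  rw [Real.rpow_neg ht.le, inv_pow, ← Real.rpow_natCast]; norm_num

/-- The translates of `x / |x|²` are uniformly bounded in `L^q(Ω)` for `q < 2`. -/
theorem exists_eLpNorm_radialField_le {Ω : Set Plane} (hΩb : Bornology.IsBounded Ω)
    {q : ℝ≥0∞} (hq1 : 1 ≤ q) (hq2 : q < 2) :
    ∃ C : ℝ≥0∞, C ≠ ⊤ ∧ ∀ y : Plane,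
      eLpNorm (fun x => radialField (x - y)) q (volume.restrict Ω) ≤ C := by
  obtain ⟨C, hC, h⟩ := exists_eLpNorm_le_of_weakL2 (X := Plane) (E := Plane)
    (hΩb.measure_lt_top (μ := volume)).ne
    (ENNReal.ofReal_ne_top (r := Real.pi)) hq1 hq2
  refine ⟨C, hC, fun y => h _ _ (by simp) ?_ fun t ht => ?_⟩
  · exact (measurable_radialField.comp (measurable_id.sub_const y)).aestronglyMeasurable
  · exact (Measure.restrict_apply_le _ _).trans (volume_lt_norm_radialField_le y ht)

theorem memLp_radialField {Ω : Set Plane} (hΩb : Bornology.IsBounded Ω)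
    {q : ℝ≥0∞} (hq1 : 1 ≤ q) (hq2 : q < 2) (y : Plane) :
    MemLp (fun x => radialField (x - y)) q (volume.restrict Ω) := by
  obtain ⟨C, hC, h⟩ := exists_eLpNorm_radialField_le hΩb hq1 hq2
  exact ⟨(measurable_radialField.comp (measurable_id.sub_const y)).aestronglyMeasurable,
    (h y).trans_lt hC.lt_top⟩

/-- Integration in polar coordinates of the radial derivative `|z|⁻² Dψ(z) z`. -/
theorem integral_fderiv_radial_complex {ψ : ℂ → ℝ} (hψ : ContDiff ℝ 1 ψ)
    (hc : HasCompactSupport ψ) :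
    ∫ z, (1 / ‖z‖ ^ 2) * fderiv ℝ ψ z z = -(2 * Real.pi) * ψ 0 := by
  let e : ℝ → ℂ := fun θ => Real.cos θ + Real.sin θ * Complex.I
  have he : Continuous e := by fun_prop
  have hen : ∀ θ, ‖e θ‖ = 1 := fun θ => by
    have := Complex.norm_polarCoord_symm ((1 : ℝ), θ)
    rw [Complex.polarCoord_symm_apply] at this
    simpa only [e, Complex.ofReal_one, one_mul, abs_one] using this
  -- The radial derivative of ψ at r e^{iθ}. The Jacobian r and the factor r from Dψ(z) z cancel 1 /
  -- |z|², so the integrand in polar coordinates is continuous up to r = 0.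
  let F : ℝ × ℝ → ℝ := fun p => fderiv ℝ ψ (p.1 * e p.2) (e p.2)
  have hF : Continuous F := by
    have := hψ.continuous_fderiv one_ne_zero
    fun_prop
  obtain ⟨R, hR0, hR⟩ : ∃ R : ℝ, 0 < R ∧ ∀ z, R < ‖z‖ → ψ z = 0 ∧ fderiv ℝ ψ z = 0 := by
    obtain ⟨R, hR0, hR⟩ := hc.isCompact.isBounded.exists_pos_norm_le
    refine ⟨R, hR0, fun z hz => ?_⟩
    have hz' : z ∉ tsupport ψ := fun h => absurd (hR z h) (not_le.2 hz)
    exact ⟨image_eq_zero_of_notMem_tsupport hz',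
      image_eq_zero_of_notMem_tsupport fun h => hz' (tsupport_fderiv_subset ℝ h)⟩
  have hFi : IntegrableOn F (Ioi 0 ×ˢ Ioo (-Real.pi) Real.pi) (volume.prod volume) := by
    have h1 : IntegrableOn F (Icc 0 R ×ˢ Icc (-Real.pi) Real.pi) (volume.prod volume) :=
      hF.continuousOn.integrableOn_compact (isCompact_Icc.prod isCompact_Icc)
    refine IntegrableOn.of_forall_sdiff_eq_zero h1 (measurableSet_Ioi.prod measurableSet_Ioo) ?_
    rintro ⟨r, θ⟩ ⟨⟨hr, hθ⟩, hn⟩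
    have hr' : R < r := by
      by_contra! h
      exact hn ⟨⟨le_of_lt hr, h⟩, Ioo_subset_Icc_self hθ⟩
    have : R < ‖(r : ℂ) * e θ‖ := by
      rw [norm_mul, hen, mul_one, Complex.norm_real]
      exact hr'.trans_le (le_abs_self r)
    simp [F, (hR _ this).2]
  -- Along each ray the derivative integrates to 0 - ψ(0), by compact support.
  have hinner : ∀ θ, ∫ r in Ioi (0 : ℝ), F (r, θ) = -ψ 0 := by
    intro θ
    let g : ℝ → ℝ := fun r => ψ (r * e θ)
    have hlin : ContDiff ℝ 1 fun r : ℝ => (r : ℂ) * e θ :=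
      (Complex.ofRealCLM.contDiff).mul contDiff_const
    have hg : ContDiff ℝ 1 g := hψ.comp hlin
    have hgc : HasCompactSupport g := by
      refine HasCompactSupport.of_support_subset_isCompact (isCompact_Icc (a := -R) (b := R)) ?_
      intro r hr
      by_contra hn
      have : R < ‖(r : ℂ) * e θ‖ := by
        rw [norm_mul, hen, mul_one, Complex.norm_real, Real.norm_eq_abs]
        by_contra! h
        exact hn (abs_le.1 h)
      exact hr (hR _ this).1
    have := hgc.integral_Ioi_deriv_eq hg 0
    have hd : ∀ r, deriv g r = F (r, θ) := by
      intro r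
      have h1 : HasDerivAt (fun r : ℝ => (r : ℂ) * e θ) (e θ) r := by
        simpa using (Complex.ofRealCLM.hasDerivAt (x := r)).mul_const (e θ)
      exact (((hψ.differentiable one_ne_zero) _).hasFDerivAt.comp_hasDerivAt r h1).deriv
    simpa [hd, g] using this
  rw [← Complex.integral_comp_polarCoord_symm, polarCoord_target]
  calc _ = ∫ p in Ioi (0 : ℝ) ×ˢ Ioo (-Real.pi) Real.pi, F p := by
        refine setIntegral_congr_fun (measurableSet_Ioi.prod measurableSet_Ioo) ?_
        rintro ⟨r, θ⟩ ⟨hr, -⟩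
        have hr : 0 < r := hr
        have h1 : Complex.polarCoord.symm (r, θ) = r • e θ := by
          rw [Complex.polarCoord_symm_apply, Complex.real_smul]
        change r • ((1 / ‖Complex.polarCoord.symm (r, θ)‖ ^ 2) *
          fderiv ℝ ψ (Complex.polarCoord.symm (r, θ)) (Complex.polarCoord.symm (r, θ))) =
          fderiv ℝ ψ (r * e θ) (e θ)
        rw [h1, ← Complex.real_smul, norm_smul, hen, map_smul, mul_one, Real.norm_eq_abs, sq_abs,
          smul_eq_mul, smul_eq_mul]
        field_simp
    -- The factors are swapped so that Fubini makes r the inner variable.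
    _ = ∫ p in Ioo (-Real.pi) Real.pi ×ˢ Ioi (0 : ℝ), F p.swap :=
        (setIntegral_prod_swap _ _ F).symm
    _ = ∫ θ in Ioo (-Real.pi) Real.pi, ∫ r in Ioi (0 : ℝ), F (r, θ) := by
        refine setIntegral_prod (fun p : ℝ × ℝ => F p.swap) ?_
        exact hFi.swap
    _ = _ := by
        simp only [hinner, setIntegral_const, measureReal_def, Real.volume_Ioo, smul_eq_mul]
        rw [ENNReal.toReal_ofReal (by linarith [Real.pi_pos])]
        ring

theorem inner_gradient_eq_fderiv (φ : Plane → ℝ) (x v : Plane) :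
    inner ℝ v (gradient φ x) = fderiv ℝ φ x v := by
  rw [real_inner_comm, gradient, InnerProductSpace.toDual_symm_apply]

theorem continuous_gradient {φ : Plane → ℝ} (hφ : ContDiff ℝ 1 φ) : Continuous (gradient φ) :=
  (InnerProductSpace.toDual ℝ Plane).symm.continuous.comp (hφ.continuous_fderiv one_ne_zero)

theorem gradient_eq_zero_of_notMem_tsupport {φ : Plane → ℝ} {x : Plane} (hx : x ∉ tsupport φ) :
    gradient φ x = 0 := by
  have : fderiv ℝ φ x = 0 :=
    image_eq_zero_of_notMem_tsupport fun h => hx (tsupport_fderiv_subset ℝ h)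
  rw [gradient, this, map_zero]

/-- The representation formula: `div (x / |x|²) = 2π δ₀` on the plane, translated to `y`. -/
theorem integral_inner_radialField_gradient {φ : Plane → ℝ} (hφ : ContDiff ℝ 1 φ)
    (hc : HasCompactSupport φ) (y : Plane) :
    ∫ x, inner ℝ (radialField (x - y)) (gradient φ x) = -(2 * Real.pi) * φ y := by
  let L : ℂ ≃ₗᵢ[ℝ] Plane := Complex.orthonormalBasisOneI.repr
  -- A measure-preserving isometry that carries the origin of ℂ to the pole y.
  let A : ℂ ≃ₜ Plane := L.toHomeomorph.trans (Homeomorph.addRight y)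
  have hA : ∀ z, A z = L z + y := fun z => rfl
  have hmp : MeasurePreserving A volume volume :=
    (measurePreserving_add_right volume y).comp L.measurePreserving
  have hψ : ContDiff ℝ 1 (φ ∘ A) :=
    hφ.comp (L.toContinuousLinearEquiv.contDiff.add contDiff_const)
  have hψc : HasCompactSupport (φ ∘ A) := hc.comp_homeomorph A
  rw [← hmp.integral_comp A.measurableEmbedding]
  have := integral_fderiv_radial_complex hψ hψc
  have h0 : (φ ∘ A) 0 = φ y := by simp [hA]
  rw [h0] at this
  rw [← this]
  refine integral_congr_ae (Filter.Eventually.of_forall fun z => ?_)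
  have hAd : HasFDerivAt A (L.toContinuousLinearEquiv : ℂ →L[ℝ] Plane) z :=
    L.toContinuousLinearEquiv.hasFDerivAt.add_const y
  have hd : fderiv ℝ (φ ∘ A) z z = fderiv ℝ φ (A z) (L z) := by
    rw [(((hφ.differentiable one_ne_zero) (A z)).hasFDerivAt.comp z hAd).fderiv]
    rfl
  simp only [inner_gradient_eq_fderiv, hd]
  rw [hA, add_sub_cancel_right, radialField, map_smul, L.norm_map, smul_eq_mul]

/-! ### Test functions, Hölder pairing and the Sobolev bound -/

theorem IsTestFunction.mul_self {Ω : Set Plane} {φ : Plane → ℝ} (hφ : IsTestFunction Ω φ) :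
    IsTestFunction Ω fun x => φ x * φ x where
  contDiff := hφ.contDiff.mul hφ.contDiff
  hasCompactSupport := hφ.hasCompactSupport.mul_left
  tsupport_subset := (tsupport_mul_subset_left (f := φ) (g := φ)).trans hφ.tsupport_subset

theorem IsTestFunction.sub {Ω : Set Plane} {φ ψ : Plane → ℝ} (hφ : IsTestFunction Ω φ)
    (hψ : IsTestFunction Ω ψ) : IsTestFunction Ω (φ - ψ) where
  contDiff := hφ.contDiff.sub hψ.contDiff
  hasCompactSupport := hφ.hasCompactSupport.sub hψ.hasCompactSupport
  tsupport_subset := (tsupport_sub φ ψ).trans (union_subset hφ.tsupport_subset hψ.tsupport_subset)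

theorem IsTestFunction.contDiff_one {Ω : Set Plane} {φ : Plane → ℝ} (hφ : IsTestFunction Ω φ) :
    ContDiff ℝ 1 φ := hφ.contDiff.of_le (by norm_cast)

theorem IsTestFunction.gradient_sub {Ω : Set Plane} {φ ψ : Plane → ℝ} (hφ : IsTestFunction Ω φ)
    (hψ : IsTestFunction Ω ψ) (x : Plane) :
    gradient (φ - ψ) x = gradient φ x - gradient ψ x := by
  rw [gradient, fderiv_sub (hφ.contDiff_one.differentiable one_ne_zero x)
    (hψ.contDiff_one.differentiable one_ne_zero x), map_sub, gradient, gradient]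

theorem IsTestFunction.memLp_gradient {Ω : Set Plane} {φ : Plane → ℝ} (hφ : IsTestFunction Ω φ)
    (p : ℝ≥0∞) : MemLp (gradient φ) p (volume.restrict Ω) := by
  refine ((continuous_gradient hφ.contDiff_one).memLp_of_hasCompactSupport ?_).restrict Ω
  exact HasCompactSupport.intro hφ.hasCompactSupport.isCompact
    fun x hx => gradient_eq_zero_of_notMem_tsupport hx

theorem IsTestFunction.setIntegral_inner_radialField {Ω : Set Plane} {φ : Plane → ℝ}
    (hφ : IsTestFunction Ω φ) (y : Plane) :
    ∫ x in Ω, inner ℝ (radialField (x - y)) (gradient φ x) = -(2 * Real.pi) * φ y := by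
  rw [← integral_inner_radialField_gradient hφ.contDiff_one hφ.hasCompactSupport y]
  refine setIntegral_eq_integral_of_forall_compl_eq_zero fun x hx => ?_
  rw [gradient_eq_zero_of_notMem_tsupport fun h => hx (hφ.tsupport_subset h), inner_zero_right]

theorem eLpNorm_inner_le {X : Type*} [MeasurableSpace X] {μ : Measure X} {p q : ℝ≥0∞}
    [ENNReal.HolderTriple q p 1] {f g : X → Plane} (hf : AEStronglyMeasurable f μ)
    (hg : AEStronglyMeasurable g μ) :
    eLpNorm (fun x => inner ℝ (f x) (g x)) 1 μ ≤ eLpNorm f q μ * eLpNorm g p μ := by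
  simpa using eLpNorm_le_eLpNorm_mul_eLpNorm_of_nnnorm (p := q) (q := p) (r := 1) hf hg
    (fun a b => inner ℝ a b) 1
    (Filter.Eventually.of_forall fun x => by simpa using nnnorm_inner_le_nnnorm (f x) (g x))

theorem integrable_inner_of_memLp {X : Type*} [MeasurableSpace X] {μ : Measure X} {p q : ℝ≥0∞}
    [ENNReal.HolderTriple q p 1] {f g : X → Plane} (hf : MemLp f q μ) (hg : MemLp g p μ) :
    Integrable (fun x => inner ℝ (f x) (g x)) μ := by
  refine memLp_one_iff_integrable.1 ⟨hf.1.inner hg.1, ?_⟩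
  exact (eLpNorm_inner_le hf.1 hg.1).trans_lt (ENNReal.mul_lt_top hf.2 hg.2)

/-- The Sobolev embedding of `W^1_p`, `p > 2`, into bounded functions, on test functions. -/
theorem exists_enorm_le_eLpNorm_gradient {Ω : Set Plane} (hΩb : Bornology.IsBounded Ω)
    {p : ℝ≥0∞} (hp : 2 < p) :
    ∃ C : ℝ≥0∞, C ≠ ⊤ ∧ ∀ φ, IsTestFunction Ω φ → ∀ y,
      ‖φ y‖ₑ ≤ C * eLpNorm (gradient φ) p (volume.restrict Ω) := by
  obtain ⟨q, hq1, hq2, hqp⟩ := exists_holderConjugate_lt_two hp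
  obtain ⟨C, hC, h⟩ := exists_eLpNorm_radialField_le hΩb hq1 hq2
  refine ⟨C, hC, fun φ hφ y => ?_⟩
  -- The factor 2π ≥ 1 is simply discarded; a sharp constant is not needed.
  calc ‖φ y‖ₑ ≤ ‖-(2 * Real.pi) * φ y‖ₑ := by
        rw [enorm_le_iff_norm_le, norm_mul]
        refine le_mul_of_one_le_left (norm_nonneg _) ?_
        rw [norm_neg, Real.norm_eq_abs]
        exact le_abs.2 (Or.inl (by linarith [Real.pi_gt_three]))
    _ = ‖∫ x in Ω, inner ℝ (radialField (x - y)) (gradient φ x)‖ₑ := by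
        rw [hφ.setIntegral_inner_radialField]
    _ ≤ eLpNorm (fun x => inner ℝ (radialField (x - y)) (gradient φ x)) 1 (volume.restrict Ω) := by
        rw [eLpNorm_one_eq_lintegral_enorm]
        exact enorm_integral_le_lintegral_enorm _
    _ ≤ eLpNorm (fun x => radialField (x - y)) q (volume.restrict Ω) *
          eLpNorm (gradient φ) p (volume.restrict Ω) :=
        eLpNorm_inner_le (memLp_radialField hΩb hq1 hq2 y).1 (hφ.memLp_gradient p).1
    _ ≤ _ := by gcongr; exact h y

/-! ### Divergence of the total drift and the form on test functions -/

theorem totalDrift_eq (b : Plane → Plane) (α : ℝ) (x : Plane) :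
    totalDrift b α x = b x - α • radialField (x - 0) := by
  rw [totalDrift, radialField, sub_zero, smul_smul, mul_one_div]

theorem memLp_totalDrift {Ω : Set Plane} (hΩ : IsOpen Ω) (hΩb : Bornology.IsBounded Ω)
    {b : Plane → Plane} (hb : MemWeakL2 Ω b) (α : ℝ) {q : ℝ≥0∞} (hq1 : 1 ≤ q) (hq2 : q < 2) :
    MemLp (totalDrift b α) q (volume.restrict Ω) := by
  rw [funext (totalDrift_eq b α)]
  exact (hb.memLp hΩ hΩb hq1 hq2).sub ((memLp_radialField hΩb hq1 hq2 0).const_smul α)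

theorem hasDistribDivergence_totalDrift {Ω : Set Plane} (hΩ : IsOpen Ω)
    (hΩb : Bornology.IsBounded Ω) {b : Plane → Plane} (hb : MemWeakL2 Ω b)
    (hdiv : HasDistribDivergence Ω b (fun _ => 0)) (α : ℝ) :
    HasDistribDivergence Ω (totalDrift b α) (fun φ => -(2 * Real.pi * α) * φ 0) := by
  -- Gradients of test functions are bounded, so the exponent p = ∞ suffices here.
  obtain ⟨q, hq1, hq2, hqp⟩ := exists_holderConjugate_lt_two (p := ⊤) (by simp)
  have : IsFiniteMeasure (volume.restrict Ω) := ⟨by simpa using hΩb.measure_lt_top⟩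
  refine ⟨IntegrableOn.locallyIntegrableOn ((memLp_totalDrift hΩ hΩb hb α hq1 hq2).integrable hq1),
    fun φ hφ => ?_⟩
  have h1 := hdiv.2 φ hφ
  have h2 := hφ.setIntegral_inner_radialField 0
  have hg := hφ.memLp_gradient ⊤
  simp only [totalDrift_eq, inner_sub_left, real_inner_smul_left]
  rw [integral_sub (integrable_inner_of_memLp (hb.memLp hΩ hΩb hq1 hq2) hg)
    ((integrable_inner_of_memLp (memLp_radialField hΩb hq1 hq2 0) hg).const_mul α),
    integral_const_mul, h2, neg_sub, sub_eq_add_neg, h1]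
  ring

/-- The form `B_α` on test functions. -/
theorem IsTestFunction.driftForm_eq {Ω : Set Plane} {b : Plane → Plane} {α : ℝ}
    (hdiv : HasDistribDivergence Ω (totalDrift b α) (fun φ => -(2 * Real.pi * α) * φ 0))
    {φ : Plane → ℝ} (hφ : IsTestFunction Ω φ) :
    driftForm Ω b α (gradient φ) φ = Real.pi * α * φ 0 ^ 2 := by
  have h := hdiv.2 _ hφ.mul_self
  have hg : ∀ x, inner ℝ (totalDrift b α x) (gradient (fun x => φ x * φ x) x) =
      2 * driftIntegrand b α (gradient φ) φ x := by
    intro x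
    have hd := (hφ.contDiff_one.differentiable one_ne_zero x)
    rw [driftIntegrand, inner_gradient_eq_fderiv, inner_gradient_eq_fderiv, fderiv_fun_mul hd hd]
    simp only [add_apply, smul_apply, smul_eq_mul]
    ring
  simp only [hg, integral_const_mul] at h
  rw [driftForm]
  linear_combination -h / 2

/-! ### Uniqueness of the weak gradient -/

theorem LocallyIntegrableOn.integrableOn_mul_test {Ω : Set Plane} (hΩ : IsOpen Ω)
    {f φ : Plane → ℝ} (hf : LocallyIntegrableOn f Ω) (hφ : IsTestFunction Ω φ) :
    IntegrableOn (fun x => f x * φ x) Ω := by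
  have hK := hφ.hasCompactSupport.isCompact
  have h1 : IntegrableOn (fun x => f x * φ x) (tsupport φ) :=
    (hf.integrableOn_compact_subset hφ.tsupport_subset hK).mul_continuousOn
      hφ.contDiff.continuous.continuousOn hK
  refine h1.of_forall_sdiff_eq_zero hΩ.measurableSet fun x hx => ?_
  rw [image_eq_zero_of_notMem_tsupport hx.2, mul_zero]

theorem LocallyIntegrableOn.coord {Ω : Set Plane} {G : Plane → Plane}
    (hG : LocallyIntegrableOn G Ω) (i : Fin 2) : LocallyIntegrableOn (fun x => G x i) Ω := by
  intro x hx
  obtain ⟨s, hs, h⟩ := hG x hx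
  exact ⟨s, hs, (EuclideanSpace.proj i : Plane →L[ℝ] ℝ).integrable_comp h⟩

/-- By the fundamental lemma of the calculus of variations, coordinate by coordinate. It lets an
arbitrary weak gradient be replaced by the L^p one that the test functions approximate. -/
theorem HasWeakGradient.ae_eq {Ω : Set Plane} (hΩ : IsOpen Ω) {u : Plane → ℝ}
    {G H : Plane → Plane} (hG : HasWeakGradient Ω u G) (hH : HasWeakGradient Ω u H) :
    G =ᵐ[volume.restrict Ω] H := by
  have key : ∀ i : Fin 2, ∀ᵐ x, x ∈ Ω → G x i - H x i = 0 := by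
    intro i
    have hGi := LocallyIntegrableOn.coord hG.2.1 i
    have hHi := LocallyIntegrableOn.coord hH.2.1 i
    refine hΩ.ae_eq_zero_of_integral_contDiff_smul_eq_zero (hGi.sub hHi) fun φ h1 h2 h3 => ?_
    have hφ : IsTestFunction Ω φ := ⟨h1, h2, h3⟩
    rw [← setIntegral_eq_integral_of_forall_compl_eq_zero (s := Ω) (fun x hx => by
      rw [image_eq_zero_of_notMem_tsupport fun h => hx (h3 h), zero_smul])]
    have e1 := hG.2.2 φ hφ i
    have e2 := hH.2.2 φ hφ i
    calc _ = ∫ x in Ω, (G x i * φ x - H x i * φ x) := by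
          refine integral_congr_ae (Filter.Eventually.of_forall fun x => ?_)
          simp only [smul_eq_mul]; ring
      _ = 0 := by
          rw [integral_sub (LocallyIntegrableOn.integrableOn_mul_test hΩ hGi hφ)
            (LocallyIntegrableOn.integrableOn_mul_test hΩ hHi hφ)]
          linarith
  rw [Filter.EventuallyEq, ae_restrict_iff' hΩ.measurableSet]
  filter_upwards [ae_all_iff.2 key] with x hx hxΩ
  ext i
  exact sub_eq_zero.1 (hx i hxΩ)

/-! ### The continuous representative -/

/-- Approximating test functions of an element of `W^1_p` with zero boundary values, `p > 2`,
converge uniformly on the plane to its continuous representative. -/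
theorem MemW1pZero.exists_continuous_representative {Ω : Set Plane}
    (hΩb : Bornology.IsBounded Ω) {p : ℝ≥0∞} (hp : 2 < p) {v : Plane → ℝ}
    (hv : MemW1pZero Ω p v) :
    ∃ (G : Plane → Plane) (w : Plane → ℝ) (φ : ℕ → Plane → ℝ) (δ : ℕ → ℝ≥0∞) (S : ℝ≥0∞),
      HasWeakGradient Ω v G ∧ MemLp G p (volume.restrict Ω) ∧ Continuous w ∧
      v =ᵐ[volume.restrict Ω] w ∧ (∀ n, IsTestFunction Ω (φ n)) ∧ (∀ n, δ n ≠ ⊤) ∧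
      Tendsto δ atTop (𝓝 0) ∧ (∀ n x, ‖φ n x - w x‖ₑ ≤ δ n) ∧ S ≠ ⊤ ∧ (∀ x, ‖w x‖ₑ ≤ S) ∧
      ∀ n, eLpNorm (fun x => gradient (φ n) x - G x) p (volume.restrict Ω) ≤ δ n := by
  obtain ⟨G, hG, hvp, hGp, happ⟩ := hv
  obtain ⟨C, hC, hsob⟩ := exists_enorm_le_eLpNorm_gradient hΩb hp
  have hp1 : 1 ≤ p := le_trans (by norm_num) hp.le
  have hp0 : p ≠ 0 := (zero_lt_one.trans_le hp1).ne'
  have hfin : IsFiniteMeasure (volume.restrict Ω) := ⟨by simpa using hΩb.measure_lt_top⟩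
  set μ := volume.restrict Ω with hμ
  let ε : ℕ → ℝ≥0∞ := fun n => ((n : ℝ≥0∞) + 1)⁻¹
  have hε0 : ∀ n, 0 < ε n := fun n => by simp [ε]
  have hεt : ∀ n, ε n ≠ ⊤ := fun n => by simp [ε]
  have hεanti : Antitone ε := fun m n h => by
    dsimp only [ε]; gcongr
  have hεlim : Tendsto ε atTop (𝓝 0) := by
    have h1 : Tendsto (fun n : ℕ => ((n + 1 : ℕ) : ℝ≥0∞)⁻¹) atTop (𝓝 0) :=
      ENNReal.tendsto_inv_nat_nhds_zero.comp (tendsto_add_atTop_nat 1)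
    simpa [ε] using h1
  choose φ hφ hφv hφG using fun n => happ (ε n) (hε0 n)
  have hφG' : ∀ n, eLpNorm (fun x => gradient (φ n) x - G x) p μ ≤ ε n := fun n =>
    (eLpNorm_sub_comm (gradient (φ n)) G p μ).trans_le (hφG n)
  -- The Sobolev bound applied to differences makes the sequence uniformly Cauchy on the plane.
  have hdist : ∀ n m y, edist (φ n y) (φ m y) ≤ C * (ε n + ε m) := by
    intro n m y
    rw [edist_eq_enorm_sub]
    refine (hsob _ ((hφ n).sub (hφ m)) y).trans ?_
    gcongr
    calc eLpNorm (gradient (φ n - φ m)) p μ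
        = eLpNorm ((fun x => gradient (φ n) x - G x) + fun x => G x - gradient (φ m) x) p μ := by
          congr 1
          ext1 x
          rw [(hφ n).gradient_sub (hφ m)]
          simp
      _ ≤ eLpNorm (fun x => gradient (φ n) x - G x) p μ +
          eLpNorm (fun x => G x - gradient (φ m) x) p μ :=
          eLpNorm_add_le (((hφ n).memLp_gradient p).1.sub hGp.1)
            (hGp.1.sub ((hφ m).memLp_gradient p).1) hp1
      _ ≤ _ := add_le_add (hφG' n) (hφG m)
  have hcauchy : ∀ y, CauchySeq fun n => φ n y := by
    intro y
    refine EMetric.cauchySeq_iff_le_tendsto_0.2 ⟨fun N => C * (ε N + ε N), fun n m N hn hm => ?_, ?_⟩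
    · exact (hdist n m y).trans (mul_le_mul' le_rfl (add_le_add (hεanti hn) (hεanti hm)))
    · simpa using ENNReal.Tendsto.const_mul (hεlim.add hεlim) (Or.inr hC)
  choose w hw using fun y => cauchySeq_tendsto_of_complete (hcauchy y)
  have hφw : ∀ n y, ‖φ n y - w y‖ₑ ≤ C * ε n := by
    intro n y
    rw [← edist_eq_enorm_sub]
    have h1 : Tendsto (fun m => edist (φ n y) (φ m y)) atTop (𝓝 (edist (φ n y) (w y))) :=
      tendsto_const_nhds.edist (hw y)
    have h2 : Tendsto (fun m => C * (ε n + ε m)) atTop (𝓝 (C * (ε n + 0))) :=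
      ENNReal.Tendsto.const_mul (tendsto_const_nhds.add hεlim) (Or.inr hC)
    rw [add_zero] at h2
    exact le_of_tendsto_of_tendsto' h1 h2 fun m => hdist n m y
  have hCε : Tendsto (fun n => C * ε n) atTop (𝓝 0) := by
    simpa using ENNReal.Tendsto.const_mul hεlim (Or.inr hC)
  have hunif : TendstoUniformly φ w atTop := by
    rw [EMetric.tendstoUniformly_iff]
    intro e he
    filter_upwards [hCε.eventually_lt_const he] with n hn y
    rw [edist_comm, edist_eq_enorm_sub]
    exact (hφw n y).trans_lt hn
  have hwc : Continuous w :=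
    hunif.continuous (Frequently.of_forall fun n => (hφ n).contDiff.continuous)
  have hae : v =ᵐ[μ] w := by
    have hb : ∀ n, eLpNorm (v - w) p μ ≤ ε n + μ univ ^ p.toReal⁻¹ * (C * ε n) := by
      intro n
      have hφm : AEStronglyMeasurable (φ n) μ := (hφ n).contDiff.continuous.aestronglyMeasurable
      calc eLpNorm (v - w) p μ = eLpNorm ((v - φ n) + (φ n - w)) p μ := by simp
        _ ≤ eLpNorm (v - φ n) p μ + eLpNorm (φ n - w) p μ :=
            eLpNorm_add_le (hvp.1.sub hφm) (hφm.sub hwc.aestronglyMeasurable) hp1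
        _ ≤ _ := by
            refine add_le_add (hφv n) ?_
            have hCn : C * ε n ≠ ⊤ := ENNReal.mul_ne_top hC (hεt n)
            refine (eLpNorm_le_of_ae_bound (C := (C * ε n).toReal)
              (Eventually.of_forall fun x => ?_)).trans_eq (by rw [ENNReal.ofReal_toReal hCn])
            rw [← toReal_enorm]
            exact ENNReal.toReal_mono hCn (hφw n x)
    have hlim : Tendsto (fun n => ε n + μ univ ^ p.toReal⁻¹ * (C * ε n)) atTop (𝓝 0) := by
      have := hεlim.add (ENNReal.Tendsto.const_mul (a := μ univ ^ p.toReal⁻¹) hCε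
        (Or.inr (ENNReal.rpow_ne_top_of_nonneg (by positivity) (measure_ne_top _ _))))
      simpa using this
    have h0 : eLpNorm (v - w) p μ = 0 :=
      le_antisymm (ge_of_tendsto' hlim hb) zero_le
    have := (eLpNorm_eq_zero_iff (hvp.1.sub hwc.aestronglyMeasurable) hp0).1 h0
    filter_upwards [this] with x hx
    exact sub_eq_zero.1 hx
  -- The sum ε n + C ε n controls both the gradient error and the uniform error; S comes from the
  -- Sobolev bound for φ 0 and its distance to w.
  refine ⟨G, w, φ, fun n => ε n + C * ε n, C * eLpNorm (gradient (φ 0)) p μ + C * ε 0, hG, hGp,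
    hwc, hae, hφ, fun n => ?_, ?_, fun n x => ?_, ?_, fun x => ?_, fun n => ?_⟩
  · exact ENNReal.add_ne_top.2 ⟨hεt n, ENNReal.mul_ne_top hC (hεt n)⟩
  · simpa using hεlim.add hCε
  · exact (hφw n x).trans le_add_self
  · exact ENNReal.add_ne_top.2
      ⟨ENNReal.mul_ne_top hC ((hφ 0).memLp_gradient p).2.ne, ENNReal.mul_ne_top hC (hεt 0)⟩
  · calc ‖w x‖ₑ = ‖φ 0 x - (φ 0 x - w x)‖ₑ := by rw [sub_sub_cancel]
      _ ≤ ‖φ 0 x‖ₑ + ‖φ 0 x - w x‖ₑ := enorm_sub_le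
      _ ≤ _ := add_le_add (hsob _ (hφ 0) x) (hφw 0 x)
  · exact (hφG' n).trans le_self_add

/-! ### Passage to the limit in the form -/

theorem eLpNorm_one_mul_le {X : Type*} [MeasurableSpace X] {μ : Measure X} {g h : X → ℝ}
    {c : ℝ≥0∞} (hc : c ≠ ⊤) (hh : ∀ x, ‖h x‖ₑ ≤ c) :
    eLpNorm (fun x => g x * h x) 1 μ ≤ eLpNorm g 1 μ * c := by
  simp only [eLpNorm_one_eq_lintegral_enorm, enorm_mul]
  rw [← lintegral_mul_const' _ _ hc]
  gcongr with x
  exact hh x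

theorem integrable_driftIntegrand {Ω : Set Plane} {p q : ℝ≥0∞} [ENNReal.HolderTriple q p 1]
    {b : Plane → Plane} {α : ℝ} {G : Plane → Plane} {w : Plane → ℝ} {S : ℝ≥0∞}
    (hB : MemLp (totalDrift b α) q (volume.restrict Ω)) (hG : MemLp G p (volume.restrict Ω))
    (hw : Continuous w) (hS : S ≠ ⊤) (hwS : ∀ x, ‖w x‖ₑ ≤ S) :
    IntegrableOn (driftIntegrand b α G w) Ω := by
  have hi := integrable_inner_of_memLp hB hG
  refine memLp_one_iff_integrable.1 ⟨hi.1.mul hw.aestronglyMeasurable, ?_⟩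
  exact (eLpNorm_one_mul_le hS hwS).trans_lt
    (ENNReal.mul_lt_top (memLp_one_iff_integrable.2 hi).2 hS.lt_top)

theorem mainTheorem3 (Ω : Set Plane) (hΩ : IsOpen Ω) (hΩb : Bornology.IsBounded Ω)
    (h0 : (0 : Plane) ∈ Ω) (b : Plane → Plane) (hb : MemWeakL2 Ω b)
    (hdiv : HasDistribDivergence Ω b (fun _ => 0)) (α : ℝ) :
    HasDistribDivergence Ω (totalDrift b α) (fun φ => -(2 * Real.pi * α) * φ 0) ∧
    ∀ p : ℝ≥0∞, 2 < p → ∀ v : Plane → ℝ, MemW1pZero Ω p v →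
      -- `w` is the continuous representative of `v`
      ∃ w : Plane → ℝ, ContinuousOn w (closure Ω) ∧ v =ᵐ[volume.restrict Ω] w ∧
        ∀ Dv : Plane → Plane, HasWeakGradient Ω v Dv →
          IntegrableOn (driftIntegrand b α Dv v) Ω ∧
          driftForm Ω b α Dv v = Real.pi * α * |w 0| ^ 2 := by
  have hdiv' := hasDistribDivergence_totalDrift hΩ hΩb hb hdiv α
  refine ⟨hdiv', fun p hp v hv => ?_⟩
  obtain ⟨G, w, φ, δ, S, hG, hGp, hwc, hvw, hφ, hδt, hδ, hφw, hS, hwS, hφG⟩ :=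
    hv.exists_continuous_representative hΩb hp
  obtain ⟨q, hq1, hq2, hqp⟩ := exists_holderConjugate_lt_two hp
  have hB := memLp_totalDrift hΩ hΩb hb α hq1 hq2
  have hintw : IntegrableOn (driftIntegrand b α G w) Ω :=
    integrable_driftIntegrand hB hGp hwc hS hwS
  refine ⟨w, hwc.continuousOn, hvw, fun Dv hDv => ?_⟩
  have hcongr : driftIntegrand b α Dv v =ᵐ[volume.restrict Ω] driftIntegrand b α G w := by
    filter_upwards [hvw, hDv.ae_eq hΩ hG] with x h1 h2
    rw [driftIntegrand, driftIntegrand, h1, h2]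
  refine ⟨hintw.congr hcongr.symm, ?_⟩
  rw [driftForm, integral_congr_ae hcongr, sq_abs]
  have hφS : ∀ n x, ‖φ n x‖ₑ ≤ S + δ n := fun n x => by
    calc ‖φ n x‖ₑ = ‖w x + (φ n x - w x)‖ₑ := by rw [add_sub_cancel]
      _ ≤ ‖w x‖ₑ + ‖φ n x - w x‖ₑ := enorm_add_le _ _
      _ ≤ _ := add_le_add (hwS x) (hφw n x)
  have hSδ : ∀ n, S + δ n ≠ ⊤ := fun n => ENNReal.add_ne_top.2 ⟨hS, hδt n⟩
  have hintwφ : ∀ n, IntegrableOn (driftIntegrand b α (gradient (φ n)) (φ n)) Ω := fun n =>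
    integrable_driftIntegrand hB ((hφ n).memLp_gradient p) (hφ n).contDiff.continuous
      (hSδ n) (hφS n)
  set μ := volume.restrict Ω with hμ
  set N := eLpNorm (totalDrift b α) q μ with hN
  set N' := eLpNorm (fun x => inner ℝ (totalDrift b α x) (G x)) 1 μ with hN'
  have hN't : N' ≠ ⊤ := (memLp_one_iff_integrable.2 (integrable_inner_of_memLp hB hGp)).2.ne
  have hbound : ∀ n, eLpNorm (driftIntegrand b α (gradient (φ n)) (φ n) - driftIntegrand b α G w)
      1 μ ≤ N * δ n * (S + δ n) + N' * δ n := by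
    intro n
    have hφm : AEStronglyMeasurable (φ n) μ := (hφ n).contDiff.continuous.aestronglyMeasurable
    have hd : AEStronglyMeasurable (fun x => gradient (φ n) x - G x) μ :=
      ((hφ n).memLp_gradient p).1.sub hGp.1
    -- The difference of products splits as b·(∇φₙ - G) φₙ + b·G (φₙ - w), with b the total drift:
    -- the first term is small by Hölder and the bound S + δ n on φₙ, the second by uniform
    -- convergence.
    calc _ = eLpNorm ((fun x => inner ℝ (totalDrift b α x) (gradient (φ n) x - G x) * φ n x) +
            fun x => inner ℝ (totalDrift b α x) (G x) * (φ n x - w x)) 1 μ := by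
          congr 1
          ext1 x
          simp only [driftIntegrand, Pi.sub_apply, Pi.add_apply, inner_sub_right]
          ring
      _ ≤ _ := eLpNorm_add_le ((hB.1.inner hd).mul hφm)
          ((hB.1.inner hGp.1).mul (hφm.sub hwc.aestronglyMeasurable)) le_rfl
      _ ≤ _ := by
          refine add_le_add ((eLpNorm_one_mul_le (hSδ n) (hφS n)).trans ?_)
            (eLpNorm_one_mul_le (hδt n) (hφw n))
          gcongr
          exact (eLpNorm_inner_le (p := p) (q := q) hB.1 hd).trans (by gcongr; exact hφG n)
  have hlim : Tendsto (fun n => N * δ n * (S + δ n) + N' * δ n) atTop (𝓝 0) := by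
    have h1 : Tendsto (fun n => N * δ n) atTop (𝓝 0) := by
      simpa using ENNReal.Tendsto.const_mul hδ (Or.inr hB.2.ne)
    have h2 : Tendsto (fun n => N' * δ n) atTop (𝓝 0) := by
      simpa using ENNReal.Tendsto.const_mul hδ (Or.inr hN't)
    have h3 : Tendsto (fun n => S + δ n) atTop (𝓝 S) := by simpa using hδ.const_add S
    simpa using (ENNReal.Tendsto.mul h1 (Or.inr hS) h3 (Or.inr ENNReal.zero_ne_top)).add h2
  have hconv := tendsto_integral_of_L1' _ hintw.1 (Eventually.of_forall hintwφ)
    (tendsto_of_tendsto_of_tendsto_of_le_of_le tendsto_const_nhds hlim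
      (fun _ => zero_le) hbound)
  have hw0 : Tendsto (fun n => φ n 0) atTop (𝓝 (w 0)) := by
    rw [tendsto_iff_edist_tendsto_0]
    refine tendsto_of_tendsto_of_tendsto_of_le_of_le tendsto_const_nhds hδ
      (fun _ => zero_le) fun n => ?_
    rw [edist_eq_enorm_sub]
    exact hφw n 0
  refine tendsto_nhds_unique hconv ?_
  have : ∀ n, ∫ x, driftIntegrand b α (gradient (φ n)) (φ n) x ∂μ = Real.pi * α * φ n 0 ^ 2 :=
    fun n => (hφ n).driftForm_eq hdiv'
  exact ((hw0.pow 2).const_mul _).congr fun n => (this n).symm
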